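/- Let $B_m$ ($m = 0, 1, 2, \dots$) be the Bernoulli polynomials, defined by $\frac{ze^{za}}{e^z-1}=\sum_{m\ge 0}\frac{B_m(a)}{m!}z^m$. Let $\mathbf N(m)$ be the number of (distinct) real roots of $B_m$, which is finite, and for $m\ge 1$ let $\mathbf A(m)$ be the largest real root of $B_m$, which exists. Then for all sufficiently large $m$ $$\frac{m}{2\pi e}-\Big(\frac1{\pi e}+\frac12\Big)<\mathbf A(m)<\frac{m}{2\pi e}+\frac{1}{4\pi e}\log m+\Big(1-\frac1{2\pi e}\Big),$$ $$\frac{2m}{\pi e}-\Big(\frac{2}{\pi e}+2\Big)<\mathbf N(m)<\frac{2m}{\pi e}+\log m+\Big(4\pi e+3-\frac{4}{\pi e}\Big).$$ Consequently, $$\lim_{m\to\infty}\frac{\mathbf N(m)}{m}=\frac{2}{\pi e},\qquad \lim_{m\to\infty}\frac{\mathbf A(m)}{m}=\frac{1}{2\pi e}.$$ -/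

import Mathlib

/-- The set of real roots of the `m`-th Bernoulli polynomial. -/
def bernoulliRealRoots (m : ℕ) : Set ℝ :=
  {x : ℝ | Polynomial.aeval x (Polynomial.bernoulli m) = 0}

/-- The number `𝐍(m)` of (distinct) real roots of the `m`-th Bernoulli polynomial. -/
noncomputable def numBernoulliRealRoots (m : ℕ) : ℕ :=
  (bernoulliRealRoots m).ncard

/-- The largest real root `𝐀(m)` of the `m`-th Bernoulli polynomial, for `m ≥ 1`. -/
noncomputable def largestBernoulliRealRoot (m : ℕ) : ℝ :=
  sSup (bernoulliRealRoots m)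

open Real Filter Topology
open scoped Nat

/-! On `[0, 1]` the Fourier series shows that `B_m` is `-A cos(2πx - πm/2)`, `A = 2 m!/(2π)^m`, up
to a relative error `8/2^m`. Since the cosine is 1-periodic and `B_m(a+1) - B_m(a) = m a^(m-1)`,
moving right adds a nonnegative error of at most `a^m`. By Stirling this stays negligible against
`A` up to `modeRange m`, while soon afterwards the single increment `m (a-1)^(m-1)` exceeds `A` and
forces `B_m > 0` (`eventually_bernoulliFun_pos`). The largest root lies between these two
thresholds.

For the count, every half-period of the cosine inside `[0, modeRange m]` contains a root by sign
change, and Rolle's theorem excludes a second root near the same zero of the cosine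
(`eventually_injOn_round`). Beyond `modeRange m` Rolle bounds the number of roots by `r` as soon as
`B_(m-r)` has none there, and `r` of order `log m / 4` suffices. The symmetry `x ↦ 1 - x` doubles
the counts. -/

theorem bernoulliFun_add_one (k : ℕ) (x : ℝ) :
    bernoulliFun k (x + 1) = bernoulliFun k x + k * x ^ (k - 1) := by
  have h := congr_arg (fun p => Polynomial.aeval x p) (Polynomial.bernoulli_comp_one_add_X k)
  simpa [bernoulliFun, Polynomial.aeval_comp, add_comm] using h

/-! ### Comparison with the leading Fourier mode -/

/-- The amplitude of the leading Fourier mode of the `m`-th Bernoulli polynomial. -/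
noncomputable def bernoulliAmp (m : ℕ) : ℝ := 2 * m ! / (2 * π) ^ m

theorem bernoulliAmp_pos (m : ℕ) : 0 < bernoulliAmp m := by
  unfold bernoulliAmp; positivity

/-- The leading Fourier mode of the `m`-th Bernoulli polynomial, up to sign and amplitude. -/
noncomputable def bernoulliMode (m : ℕ) (a : ℝ) : ℝ := cos (2 * π * a - π * m / 2)

theorem bernoulliMode_add_one (m : ℕ) (a : ℝ) : bernoulliMode m (a + 1) = bernoulliMode m a := by
  unfold bernoulliMode
  rw [show 2 * π * (a + 1) - π * m / 2 = 2 * π * a - π * m / 2 + 2 * π by ring, cos_add_two_pi]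

theorem abs_bernoulliMode_le_one (m : ℕ) (a : ℝ) : |bernoulliMode m a| ≤ 1 :=
  abs_cos_le_one _

theorem fourier_add_fourier_neg_eq (k : ℕ) (x : ℝ) :
    fourier 1 (x : UnitAddCircle) + (-1 : ℂ) ^ k * fourier (-1) (x : UnitAddCircle)
      = Complex.I ^ k * (2 * (bernoulliMode k x : ℂ)) := by
  have hI : Complex.I ^ k = Complex.exp (π * k / 2 * Complex.I) := by
    conv_lhs => rw [← Complex.exp_pi_div_two_mul_I]
    rw [← Complex.exp_nat_mul]
    ring_nf
  have h1 : (-1 : ℂ) ^ k = Complex.exp (π * k * Complex.I) := by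
    rw [← Complex.exp_pi_mul_I, ← Complex.exp_nat_mul]
    ring_nf
  rw [fourier_coe_apply, fourier_coe_apply, hI, h1, bernoulliMode, Complex.ofReal_cos,
    Complex.two_cos, mul_add, ← Complex.exp_add, ← Complex.exp_add, ← Complex.exp_add]
  push_cast
  ring_nf

theorem abs_bernoulliFun_add_mode_le_of_mem_Icc {k : ℕ} (hk : 2 ≤ k) {x : ℝ}
    (hx : x ∈ Set.Icc (0 : ℝ) 1) :
    |bernoulliFun k x + bernoulliAmp k * bernoulliMode k x| ≤ bernoulliAmp k * (8 / 2 ^ k) := by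
  have hs := hasSum_one_div_nat_pow_mul_fourier hk hx
  have hs2 := (hasSum_nat_add_iff' 2).mpr hs
  have hz : HasSum (fun n : ℕ => 8 / 2 ^ k * ((1 : ℝ) / ((n + 2 : ℕ) : ℝ) ^ 2))
      (8 / 2 ^ k * (π ^ 2 / 6 - 1)) := by
    have := ((hasSum_nat_add_iff' 2).mpr hasSum_zeta_two).mul_left (8 / 2 ^ k)
    simpa [Finset.sum_range_succ] using this
  have hb := tsum_of_norm_bounded (f := fun n : ℕ => (1 : ℂ) / ((n + 2 : ℕ) : ℂ) ^ k *
      (fourier ((n + 2 : ℕ) : ℤ) (x : UnitAddCircle) +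
        (-1 : ℂ) ^ k * fourier (-((n + 2 : ℕ) : ℤ)) (x : UnitAddCircle))) hz (by
    intro n
    rw [norm_mul, norm_div, norm_one, norm_pow, Complex.norm_natCast]
    have h1 : ‖fourier ((n + 2 : ℕ) : ℤ) (x : UnitAddCircle) +
        (-1 : ℂ) ^ k * fourier (-((n + 2 : ℕ) : ℤ)) (x : UnitAddCircle)‖ ≤ 2 := by
      refine (norm_add_le _ _).trans ?_
      rw [norm_mul, norm_pow, norm_neg, norm_one, one_pow, fourier_apply, fourier_apply,
        Circle.norm_coe, Circle.norm_coe]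
      norm_num
    -- Keep two powers for convergence and bound the other `k - 2` by `(n + 2)^(k-2) ≥ 2^(k-2)`.
    have h2 : (1 : ℝ) / ((n + 2 : ℕ) : ℝ) ^ k ≤ 4 / 2 ^ k * (1 / ((n + 2 : ℕ) : ℝ) ^ 2) := by
      obtain ⟨l, rfl⟩ := Nat.exists_eq_add_of_le hk
      rw [div_mul_div_comm, mul_one, div_le_div_iff₀ (by positivity) (by positivity), pow_add,
        pow_add]
      have : (2 : ℝ) ^ l ≤ ((n + 2 : ℕ) : ℝ) ^ l := by
        gcongr; push_cast; linarith [(Nat.cast_nonneg n : (0 : ℝ) ≤ n)]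
      have h3 : (0 : ℝ) ≤ ((n + 2 : ℕ) : ℝ) ^ 2 := by positivity
      nlinarith
    calc _ ≤ 4 / 2 ^ k * (1 / ((n + 2 : ℕ) : ℝ) ^ 2) * 2 := by gcongr
      _ = _ := by ring)
  rw [hs2.tsum_eq] at hb
  have hk0 : k ≠ 0 := by lia
  simp only [Finset.sum_range_succ, Finset.sum_range_zero, Nat.cast_zero, zero_pow hk0, div_zero,
    zero_mul, zero_add, Nat.cast_one, one_pow, div_one, one_mul,
    fourier_add_fourier_neg_eq] at hb
  have hA : (2 * π) ^ k / k ! * bernoulliAmp k = 2 := by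
    unfold bernoulliAmp; field_simp
  have hA' : (((2 * π) ^ k / k ! * bernoulliAmp k : ℝ) : ℂ) = 2 := by rw [hA]; simp
  have he : -(2 * π * Complex.I) ^ k / k ! * (bernoulliFun k x : ℂ)
      - Complex.I ^ k * (2 * (bernoulliMode k x : ℂ))
      = - Complex.I ^ k * (((2 * π) ^ k / k ! *
        (bernoulliFun k x + bernoulliAmp k * bernoulliMode k x) : ℝ) : ℂ) := by
    push_cast at hA' ⊢
    rw [mul_pow]
    linear_combination Complex.I ^ k * (bernoulliMode k x : ℂ) * hA'
  rw [he, norm_mul, norm_neg, norm_pow, Complex.norm_I, one_pow, one_mul, Complex.norm_real,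
    Real.norm_eq_abs, abs_mul, abs_of_pos (by positivity : 0 < (2 * π) ^ k / (k ! : ℝ))] at hb
  have hpi : π ^ 2 / 6 - 1 ≤ 2 := by nlinarith [pi_lt_d2, pi_pos]
  have hP : 0 < (2 * π) ^ k / (k ! : ℝ) := by positivity
  refine le_of_mul_le_mul_left (hb.trans ?_) hP
  rw [← mul_assoc, hA, mul_comm]
  gcongr

theorem pow_add_mul_pow_le_add_one_pow {a : ℝ} (ha : 0 ≤ a) (k : ℕ) :
    a ^ k + k * a ^ (k - 1) ≤ (a + 1) ^ k := by
  induction k with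
  | zero => simp
  | succ k ih =>
    have h1 : (k : ℝ) * a ^ (k - 1) * a = k * a ^ k := by
      cases k with
      | zero => simp
      | succ k => simp [pow_succ]; ring
    have h2 : 0 ≤ (k : ℝ) * a ^ (k - 1) := by positivity
    have := mul_le_mul_of_nonneg_right ih (by linarith : 0 ≤ a + 1)
    simp only [Nat.add_sub_cancel, pow_succ, Nat.cast_add, Nat.cast_one] at *
    nlinarith

/-- Each unit step leaves the mode unchanged and adds `k a^(k-1)`, which is nonnegative and at most
`(a+1)^k - a^k`, so the upper errors telescope. -/
theorem bernoulliFun_add_mode_mem_Icc {k : ℕ} (hk : 2 ≤ k) {a : ℝ} (ha : 0 ≤ a) :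
    bernoulliFun k a + bernoulliAmp k * bernoulliMode k a ∈
      Set.Icc (-(bernoulliAmp k * (8 / 2 ^ k))) (bernoulliAmp k * (8 / 2 ^ k) + a ^ k) := by
  have key : ∀ n : ℕ, ∀ x : ℝ, x ∈ Set.Icc (0 : ℝ) 1 →
      bernoulliFun k (x + n) + bernoulliAmp k * bernoulliMode k (x + n) ∈
      Set.Icc (-(bernoulliAmp k * (8 / 2 ^ k)))
        (bernoulliAmp k * (8 / 2 ^ k) + (x + n) ^ k) := by
    intro n x hx
    induction n with
    | zero =>
      have := abs_le.mp (abs_bernoulliFun_add_mode_le_of_mem_Icc hk hx)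
      have h0 : 0 ≤ x ^ k := pow_nonneg hx.1 k
      simp only [Nat.cast_zero, add_zero]
      exact ⟨this.1, by linarith [this.2]⟩
    | succ n ih =>
      have hxn : 0 ≤ x + n := by have := hx.1; positivity
      have h1 := pow_add_mul_pow_le_add_one_pow hxn k
      have h2 : 0 ≤ (k : ℝ) * (x + n) ^ (k - 1) := by positivity
      push_cast
      rw [← add_assoc, bernoulliFun_add_one, bernoulliMode_add_one]
      exact ⟨by linarith [ih.1], by linarith [ih.2]⟩
  have := key ⌊a⌋₊ (a - ⌊a⌋₊)
    ⟨sub_nonneg.mpr (Nat.floor_le ha), by linarith [Nat.lt_floor_add_one a]⟩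
  rwa [sub_add_cancel] at this

/-- Only the last unit step, from `a - 1` to `a`, is kept; everything before it is bounded below by
the mode. -/
theorem le_bernoulliFun_of_one_le {k : ℕ} (hk : 2 ≤ k) {a : ℝ} (ha : 1 ≤ a) :
    k * (a - 1) ^ (k - 1) - bernoulliAmp k * (1 + 8 / 2 ^ k) ≤ bernoulliFun k a := by
  have h := (bernoulliFun_add_mode_mem_Icc hk (sub_nonneg.mpr ha)).1
  have h2 := bernoulliFun_add_one k (a - 1)
  have h3 := (abs_le.mp (abs_bernoulliMode_le_one k (a - 1))).2
  have := bernoulliAmp_pos k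
  rw [sub_add_cancel] at h2
  nlinarith

/-! ### Stirling estimates and the two thresholds -/

theorem bernoulliAmp_eq {m : ℕ} (hm : m ≠ 0) :
    bernoulliAmp m =
      2 * √2 * √m * Stirling.stirlingSeq m * (m / (2 * π * exp 1)) ^ m := by
  have hm' : (0 : ℝ) < m := by positivity
  unfold bernoulliAmp Stirling.stirlingSeq
  rw [sqrt_mul (by norm_num)]
  have : (m / (2 * π * exp 1)) ^ m = (m / exp 1) ^ m / (2 * π) ^ m := by
    rw [← div_pow]; congr 1; field_simp
  rw [this]
  have h1 : √(m : ℝ) ≠ 0 := by positivity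
  field_simp

theorem sqrt_mul_pow_le_bernoulliAmp {m : ℕ} (hm : m ≠ 0) :
    √m * (m / (2 * π * exp 1)) ^ m ≤ bernoulliAmp m := by
  rw [bernoulliAmp_eq hm]
  have h1 : 1 ≤ Stirling.stirlingSeq m := by
    refine le_trans ?_ (Stirling.sqrt_pi_le_stirlingSeq hm)
    rw [one_le_sqrt]; linarith [pi_gt_three]
  have h2 : (1 : ℝ) ≤ √2 := by rw [one_le_sqrt]; norm_num
  have h3 : 1 ≤ 2 * √2 * Stirling.stirlingSeq m := by nlinarith
  have h4 : 0 ≤ √(m : ℝ) * (m / (2 * π * exp 1)) ^ m := by positivity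
  nlinarith

theorem sqrt_eq_exp_log_div_two {x : ℝ} (hx : 0 < x) : √x = exp (log x / 2) := by
  rw [exp_half, exp_log hx]

theorem tendsto_log_natCast : Tendsto (fun m : ℕ => log (m : ℝ)) atTop atTop :=
  tendsto_log_atTop.comp tendsto_natCast_atTop_atTop

theorem eventually_pow_le_bernoulliAmp (K : ℝ) {δ : ℝ} (hδ : 0 < δ) :
    ∀ᶠ m : ℕ in atTop, ∀ a : ℝ, 0 ≤ a → a ≤ (m + log m / 4 + K) / (2 * π * exp 1) →
      a ^ m ≤ δ * bernoulliAmp m := by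
  filter_upwards [eventually_ge_atTop 1,
    tendsto_log_natCast.eventually_ge_atTop (4 * (K - log δ))] with m hm hlog a ha haT
  have hm' : (0 : ℝ) < m := by positivity
  set u := log m / 4 + K with hu
  have h1 : a ^ m ≤ (m / (2 * π * exp 1)) ^ m * exp u := by
    calc a ^ m ≤ (m / (2 * π * exp 1) * exp (u / m)) ^ m := by
          refine pow_le_pow_left₀ ha (haT.trans ?_) m
          have := add_one_le_exp (u / m)
          calc (m + log m / 4 + K) / (2 * π * exp 1)
              = m / (2 * π * exp 1) * (u / m + 1) := by rw [hu]; field_simp; ring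
            _ ≤ _ := by gcongr
      _ = _ := by
          rw [mul_pow, ← exp_nat_mul]; congr 2; field_simp
  -- Here `exp u` grows like `m^(1/4)`, which the factor `√m` in the amplitude beats.
  have h2 : exp u ≤ δ * √m := by
    rw [sqrt_eq_exp_log_div_two hm', ← exp_log hδ, ← exp_add, exp_le_exp]
    linarith
  calc a ^ m ≤ (m / (2 * π * exp 1)) ^ m * (δ * √m) := h1.trans (by gcongr)
    _ = δ * (√m * (m / (2 * π * exp 1)) ^ m) := by ring
    _ ≤ _ := by gcongr; exact sqrt_mul_pow_le_bernoulliAmp (by lia)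

theorem tendsto_log_sq_div : Tendsto (fun m : ℕ => log (m : ℝ) ^ 2 / m) atTop (𝓝 0) :=
  ((isLittleO_pow_log_id_atTop (n := 2)).tendsto_div_nhds_zero).comp tendsto_natCast_atTop_atTop

theorem tendsto_log_div : Tendsto (fun m : ℕ => log (m : ℝ) / m) atTop (𝓝 0) :=
  (isLittleO_log_id_atTop.tendsto_div_nhds_zero).comp tendsto_natCast_atTop_atTop

theorem tendsto_eight_div_two_pow : Tendsto (fun m : ℕ => (8 : ℝ) / 2 ^ m) atTop (𝓝 0) :=
  tendsto_const_nhds.div_atTop (tendsto_pow_atTop_atTop_of_one_lt (by norm_num))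

/-- With `v = log m / 2 - 1`, the power on the right gains a factor close to `exp v = √m / e` over
`(m/(2πe))^(m-1)`. The ratio of the two sides then tends to `√(2π)/π < 1`. -/
theorem eventually_bernoulliAmp_lt_mul_pow :
    ∀ᶠ m : ℕ in atTop, bernoulliAmp m * (1 + 8 / 2 ^ m) <
      m * ((m - 1 + log m / 2) / (2 * π * exp 1)) ^ (m - 1) := by
  have hw : Tendsto (fun m : ℕ => ((log (m : ℝ) ^ 2 / m) / 4 - log (m : ℝ) / m / 2) /
      (1 + (log (m : ℝ) / m / 2 - 1 / m))) atTop (𝓝 ((0 / 4 - 0 / 2) / (1 + (0 / 2 - 0)))) := by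
    refine Tendsto.div ?_ ?_ (by norm_num)
    · exact (tendsto_log_sq_div.div_const 4).sub (tendsto_log_div.div_const 2)
    · exact ((tendsto_log_div.div_const 2).sub tendsto_one_div_atTop_nhds_zero_nat).const_add 1
  have hlim : Tendsto (fun m : ℕ => √2 * Stirling.stirlingSeq m * (1 + 8 / 2 ^ m) *
      exp (((log (m : ℝ) ^ 2 / m) / 4 - log (m : ℝ) / m / 2) /
      (1 + (log (m : ℝ) / m / 2 - 1 / m)))) atTop
      (𝓝 (√2 * √π * (1 + 0) * exp ((0 / 4 - 0 / 2) / (1 + (0 / 2 - 0))))) :=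
    ((Stirling.tendsto_stirlingSeq_sqrt_pi.const_mul _).mul
      (tendsto_eight_div_two_pow.const_add 1)).mul ((continuous_exp.tendsto _).comp hw)
  have hlt : √2 * √π * (1 + 0) * exp ((0 / 4 - 0 / 2) / (1 + (0 / 2 - 0))) < π := by
    rw [← sqrt_mul (by norm_num)]
    simp only [zero_div, sub_zero, add_zero, mul_one, exp_zero]
    rw [sqrt_lt' pi_pos]
    nlinarith [pi_gt_three]
  filter_upwards [hlim.eventually_lt_const hlt, eventually_ge_atTop 1,
    tendsto_log_natCast.eventually_ge_atTop 2] with m h hm hlog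
  have hm' : (0 : ℝ) < m := by positivity
  set v := log m / 2 - 1 with hv
  have hv0 : 0 ≤ v := by linarith
  have hmv : 0 < m + v := by linarith
  have hpow : (m - 1 + log m / 2) / (2 * π * exp 1)
      = m / (2 * π * exp 1) * (1 + v / m) := by rw [hv]; field_simp; ring
  have hw' : ((log (m : ℝ) ^ 2 / m) / 4 - log (m : ℝ) / m / 2) /
      (1 + (log (m : ℝ) / m / 2 - 1 / m)) = v * (v + 1) / (m + v) := by
    have e1 : (log (m : ℝ) ^ 2 / m) / 4 - log (m : ℝ) / m / 2 = v * (v + 1) / m := by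
      rw [hv]; field_simp; ring
    have e2 : 1 + (log (m : ℝ) / m / 2 - 1 / m) = (m + v) / m := by
      rw [hv]; field_simp
    rw [e1, e2]; field_simp
  rw [hw'] at h
  -- From `log y ≥ 1 - 1/y`; the correction `v(v+1)/(m+v)` tends to 0.
  have hlow : exp (v - v * (v + 1) / (m + v)) ≤ (1 + v / m) ^ (m - 1) := by
    have h1 : 0 < 1 + v / m := by positivity
    have h2 := one_sub_inv_le_log_of_pos h1
    rw [← exp_log (pow_pos h1 (m - 1)), log_pow, exp_le_exp]
    calc v - v * (v + 1) / (m + v) = ((m - 1 : ℕ) : ℝ) * (1 - (1 + v / m)⁻¹) := by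
          rw [Nat.cast_pred (by lia)]
          have : 1 - (1 + v / m)⁻¹ = v / (m + v) := by
            rw [show 1 + v / m = (m + v) / m by field_simp, inv_div]; field_simp
            ring
          rw [this]; field_simp; ring
      _ ≤ _ := by gcongr
  have hexp : exp v = √m / exp 1 := by
    rw [hv, exp_sub, sqrt_eq_exp_log_div_two hm']
  have hP : (m / (2 * π * exp 1)) ^ m = (m / (2 * π * exp 1)) ^ (m - 1) * (m / (2 * π * exp 1)) := by
    rw [← pow_succ, Nat.sub_add_cancel hm]
  rw [bernoulliAmp_eq (by lia), hpow, mul_pow, hP]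
  have hE := exp_pos (v * (v + 1) / (m + v))
  rw [exp_sub, hexp] at hlow
  have hsm : 0 < √(m : ℝ) := by positivity
  calc 2 * √2 * √m * Stirling.stirlingSeq m *
        ((m / (2 * π * exp 1)) ^ (m - 1) * (m / (2 * π * exp 1))) * (1 + 8 / 2 ^ m)
      = m * (m / (2 * π * exp 1)) ^ (m - 1) * (√m / exp 1 / π) *
        (√2 * Stirling.stirlingSeq m * (1 + 8 / 2 ^ m)) := by field_simp
    _ < m * (m / (2 * π * exp 1)) ^ (m - 1) * (√m / exp 1 / π) *
        (π / exp (v * (v + 1) / (m + v))) := by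
        gcongr
        rwa [lt_div_iff₀ hE]
    _ = m * ((m / (2 * π * exp 1)) ^ (m - 1) * (√m / exp 1 / exp (v * (v + 1) / (m + v)))) := by
        field_simp
    _ ≤ _ := by gcongr

theorem eventually_bernoulliFun_pos :
    ∀ᶠ m : ℕ in atTop, ∀ a : ℝ, 1 + (m - 1 + log m / 2) / (2 * π * exp 1) ≤ a →
      0 < bernoulliFun m a := by
  filter_upwards [eventually_bernoulliAmp_lt_mul_pow, eventually_ge_atTop 2] with m h hm a ha
  have hm' : (2 : ℝ) ≤ m := by exact_mod_cast hm
  have hl : 0 ≤ log (m : ℝ) := log_nonneg (by linarith)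
  have h0 : 0 ≤ (m - 1 + log m / 2) / (2 * π * exp 1) :=
    div_nonneg (by linarith) (by positivity)
  have h1 := le_bernoulliFun_of_one_le hm (by linarith : 1 ≤ a)
  have h2 : (m : ℝ) * ((m - 1 + log m / 2) / (2 * π * exp 1)) ^ (m - 1)
      ≤ m * (a - 1) ^ (m - 1) := by gcongr; linarith
  linarith

theorem eventually_abs_bernoulliFun_add_mode_le (K : ℝ) {δ : ℝ} (hδ : 0 < δ) :
    ∀ᶠ m : ℕ in atTop, ∀ a : ℝ, 0 ≤ a → a ≤ (m + log m / 4 + K) / (2 * π * exp 1) →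
      |bernoulliFun m a + bernoulliAmp m * bernoulliMode m a| ≤ δ * bernoulliAmp m := by
  filter_upwards [eventually_pow_le_bernoulliAmp K (half_pos hδ), eventually_ge_atTop 2,
    tendsto_eight_div_two_pow.eventually_le_const (half_pos hδ)] with m h hm h8 a ha haT
  have h1 := bernoulliFun_add_mode_mem_Icc hm ha
  have h2 := h a ha haT
  have h3 := bernoulliAmp_pos m
  have h4 : 0 ≤ a ^ m := pow_nonneg ha m
  have h5 := mul_le_mul_of_nonneg_left h8 h3.le
  rw [abs_le]
  exact ⟨by linarith [h1.1], by linarith [h1.2]⟩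

/-! ### Finiteness, symmetry and Rolle's theorem for the roots -/

theorem mem_bernoulliRealRoots {m : ℕ} {x : ℝ} :
    x ∈ bernoulliRealRoots m ↔ bernoulliFun m x = 0 := by
  simp [bernoulliRealRoots, bernoulliFun, Polynomial.eval_map_algebraMap]

theorem polynomial_bernoulli_ne_zero (m : ℕ) : Polynomial.bernoulli m ≠ 0 := by
  intro h
  have := Polynomial.coeff_bernoulli m m
  simp [h] at this

theorem finite_bernoulliRealRoots (m : ℕ) : (bernoulliRealRoots m).Finite := by
  refine ((Polynomial.bernoulli m).rootSet_finite ℝ).subset fun x hx => ?_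
  rw [Polynomial.mem_rootSet]
  exact ⟨polynomial_bernoulli_ne_zero m, hx⟩

theorem one_sub_mem_bernoulliRealRoots {m : ℕ} {x : ℝ} (hx : x ∈ bernoulliRealRoots m) :
    1 - x ∈ bernoulliRealRoots m := by
  rw [mem_bernoulliRealRoots] at *
  rw [bernoulliFun_eval_one_sub, hx, mul_zero]

theorem exists_bernoulliFun_eq_zero_of_lt {m : ℕ} {x y : ℝ} (hxy : x < y)
    (h : bernoulliFun (m + 1) x = bernoulliFun (m + 1) y) :
    ∃ z ∈ Set.Ioo x y, bernoulliFun m z = 0 := by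
  obtain ⟨z, hz, hz'⟩ := exists_deriv_eq_zero hxy
    (continuous_bernoulliFun (m + 1)).continuousOn h
  refine ⟨z, hz, ?_⟩
  rw [deriv_bernoulliFun] at hz'
  simpa [Nat.cast_add_one_ne_zero] using hz'

theorem nonempty_bernoulliRealRoots {m : ℕ} (hm : 1 ≤ m) : (bernoulliRealRoots m).Nonempty := by
  obtain ⟨z, -, hz⟩ := exists_bernoulliFun_eq_zero_of_lt (m := m) zero_lt_one
    (bernoulliFun_endpoints_eq_of_ne_one (by lia)).symm
  exact ⟨z, mem_bernoulliRealRoots.mpr hz⟩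

theorem isGreatest_largestBernoulliRealRoot {m : ℕ} (hm : 1 ≤ m) :
    IsGreatest (bernoulliRealRoots m) (largestBernoulliRealRoot m) :=
  ⟨(nonempty_bernoulliRealRoots hm).csSup_mem (finite_bernoulliRealRoots m),
    fun _ hx => le_csSup (finite_bernoulliRealRoots m).bddAbove hx⟩

theorem ncard_bernoulliRealRoots_gt_succ_le (m : ℕ) (t : ℝ) :
    (bernoulliRealRoots (m + 1) ∩ Set.Ioi t).ncard ≤
      (bernoulliRealRoots m ∩ Set.Ioi t).ncard + 1 := by
  have h1 := (finite_bernoulliRealRoots (m + 1)).inter_of_left (Set.Ioi t)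
  have h2 := (finite_bernoulliRealRoots m).inter_of_left (Set.Ioi t)
  rw [Set.ncard_eq_toFinset_card _ h1, Set.ncard_eq_toFinset_card _ h2]
  refine Finset.card_le_of_interleaved fun x hx y hy hxy _ => ?_
  simp only [Set.Finite.mem_toFinset, Set.mem_inter_iff, mem_bernoulliRealRoots,
    Set.mem_Ioi] at hx hy ⊢
  obtain ⟨z, hz, hz'⟩ := exists_bernoulliFun_eq_zero_of_lt hxy (hx.1.trans hy.1.symm)
  exact ⟨z, ⟨hz', hx.2.trans hz.1⟩, hz.1, hz.2⟩

theorem ncard_bernoulliRealRoots_gt_le {m : ℕ} {t : ℝ} (h : ∀ x, t < x → bernoulliFun m x ≠ 0)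
    (r : ℕ) : (bernoulliRealRoots (m + r) ∩ Set.Ioi t).ncard ≤ r := by
  induction r with
  | zero =>
    rw [add_zero, Nat.le_zero, Set.ncard_eq_zero ((finite_bernoulliRealRoots m).inter_of_left _),
      Set.eq_empty_iff_forall_notMem]
    exact fun x hx => h x hx.2 (mem_bernoulliRealRoots.mp hx.1)
  | succ r ih => exact (ncard_bernoulliRealRoots_gt_succ_le (m + r) t).trans (by lia)

/-! ### Roots beyond the mode range -/

/-- The endpoint up to which the leading Fourier mode dominates the Bernoulli polynomial. -/
noncomputable def modeRange (m : ℕ) : ℝ := (m + log m / 4) / (2 * π * exp 1)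

theorem eventually_ncard_bernoulliRealRoots_gt_modeRange_le :
    ∀ᶠ m : ℕ in atTop, ((bernoulliRealRoots m ∩ Set.Ioi (modeRange m)).ncard : ℝ) ≤
      log m / 4 + 2 * π * exp 1 + 1 := by
  obtain ⟨M, hM⟩ := eventually_atTop.mp eventually_bernoulliFun_pos
  have hE : 0 < 2 * π * exp 1 := by positivity
  filter_upwards [eventually_ge_atTop 1,
    tendsto_natCast_atTop_atTop.eventually_ge_atTop (2 * (M + 2 * π * exp 1 + 2))] with m hm hmM
  have hm' : (1 : ℝ) ≤ m := by exact_mod_cast hm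
  have hl0 : 0 ≤ log (m : ℝ) := log_nonneg hm'
  have hlm : log (m : ℝ) ≤ m := by linarith [log_le_sub_one_of_pos (by linarith : (0 : ℝ) < m)]
  -- Large enough that the positivity threshold of `B_(m-r)` lies at or below `modeRange m`.
  set r := ⌈log (m : ℝ) / 4 + 2 * π * exp 1⌉₊ with hr
  have hr1 : log (m : ℝ) / 4 + 2 * π * exp 1 ≤ r := Nat.le_ceil _
  have hr2 : (r : ℝ) < log (m : ℝ) / 4 + 2 * π * exp 1 + 1 := Nat.ceil_lt_add_one (by positivity)
  have hrm : M + 1 + r ≤ m := by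
    have : (M : ℝ) + 1 + r ≤ m := by linarith
    exact_mod_cast this
  clear_value r
  clear hr
  obtain ⟨n, rfl⟩ := Nat.exists_eq_add_of_le' (show r ≤ m by lia)
  refine le_trans ?_ hr2.le
  refine Nat.cast_le.mpr (ncard_bernoulliRealRoots_gt_le (fun x hx => (hM n (by lia) x ?_).ne') r)
  refine le_trans ?_ hx.le
  have hn : (1 : ℝ) ≤ n := by exact_mod_cast (by lia : 1 ≤ n)
  have hln : log (n : ℝ) ≤ log ((n + r : ℕ) : ℝ) := log_le_log (by linarith) (by simp)
  unfold modeRange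
  rw [le_div_iff₀ hE, add_mul, div_mul_cancel₀ _ hE.ne']
  push_cast at *
  linarith

/-! ### Upper bound for the roots inside the mode range -/

theorem half_lt_sin_pi_mul {t : ℝ} (h1 : 1 / 4 < t) (h2 : t ≤ 1 / 2) : 1 / 2 < sin (π * t) := by
  rw [← sin_pi_div_six]
  have := pi_pos
  exact sin_lt_sin_of_lt_of_le_pi_div_two (by nlinarith) (by nlinarith) (by nlinarith)

theorem half_lt_cos_pi_mul {t : ℝ} (h : |t| ≤ 1 / 4) : 1 / 2 < cos (π * t) := by
  rw [← cos_pi_div_three, ← cos_abs (π * t), abs_mul, abs_of_pos pi_pos]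
  have := pi_pos
  have := abs_nonneg t
  exact cos_lt_cos_of_nonneg_of_le_pi (by positivity) (by nlinarith) (by nlinarith)

theorem abs_bernoulliMode_eq_abs_sin (m : ℕ) (x : ℝ) (j : ℤ) :
    |bernoulliMode m x| = |sin (π * (2 * x - m / 2 - 1 / 2 - j))| := by
  rw [bernoulliMode, show 2 * π * x - π * m / 2 =
    π * (2 * x - m / 2 - 1 / 2 - j) + π / 2 + j * π by ring, cos_add_int_mul_pi, cos_add_pi_div_two,
    abs_mul, abs_neg_one_zpow, one_mul, abs_neg]

theorem abs_bernoulliMode_eq_abs_cos (m : ℕ) (x : ℝ) (j : ℤ) :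
    |bernoulliMode m x| = |cos (π * (2 * x - (m + 1 : ℕ) / 2 - 1 / 2 - j))| := by
  rw [bernoulliMode, show 2 * π * x - π * m / 2 =
    π * (2 * x - (m + 1 : ℕ) / 2 - 1 / 2 - j) + (j + 1 : ℤ) * π by push_cast; ring,
    cos_add_int_mul_pi, abs_mul, abs_neg_one_zpow, one_mul]

theorem abs_sub_le_quarter_of_abs_bernoulliMode_le {m : ℕ} {x : ℝ}
    (h : |bernoulliMode m x| ≤ 1 / 2) :
    |2 * x - m / 2 - 1 / 2 - round (2 * x - m / 2 - 1 / 2)| ≤ 1 / 4 := by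
  rw [abs_bernoulliMode_eq_abs_sin m x (round (2 * x - m / 2 - 1 / 2))] at h
  have h1 := abs_sub_round (2 * x - (m : ℝ) / 2 - 1 / 2)
  generalize 2 * x - (m : ℝ) / 2 - 1 / 2 - round (2 * x - (m : ℝ) / 2 - 1 / 2) = t at *
  by_contra! hlt
  have h2 := half_lt_sin_pi_mul hlt h1
  rcases abs_cases t with ⟨e, -⟩ | ⟨e, -⟩ <;> rw [e] at h2
  · linarith [le_abs_self (sin (π * t))]
  · rw [mul_neg, sin_neg] at h2
    linarith [neg_abs_le (sin (π * t))]

theorem abs_bernoulliMode_le_of_bernoulliFun_eq_zero {m : ℕ} {x δ : ℝ}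
    (h : |bernoulliFun m x + bernoulliAmp m * bernoulliMode m x| ≤ δ * bernoulliAmp m)
    (hx : bernoulliFun m x = 0) : |bernoulliMode m x| ≤ δ := by
  have := bernoulliAmp_pos m
  rw [hx, zero_add, abs_mul, abs_of_pos this, mul_comm] at h
  exact le_of_mul_le_mul_right h this

theorem modeRange_succ_le {m : ℕ} (hm : 1 ≤ m) :
    modeRange (m + 1) ≤ (m + log m / 4 + 2) / (2 * π * exp 1) := by
  have hm' : (1 : ℝ) ≤ m := by exact_mod_cast hm
  have h1 : log ((m + 1 : ℕ) : ℝ) ≤ log m + 1 := by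
    have : ((m + 1 : ℕ) : ℝ) = m * (1 + 1 / m) := by push_cast; field_simp
    rw [this, log_mul (by positivity) (by positivity)]
    have h2 := log_le_sub_one_of_pos (by positivity : (0 : ℝ) < 1 + 1 / m)
    have h3 : 1 / (m : ℝ) ≤ 1 := by rw [div_le_one (by linarith)]; exact hm'
    linarith
  unfold modeRange
  refine div_le_div_of_nonneg_right ?_ (by positivity)
  push_cast at *
  linarith

/-- The rounded value names the zero of the mode nearest to the root. Two roots sharing it are both
within a quarter, in units of half-periods, of that zero. Rolle puts a root of the previous
Bernoulli polynomial between them, where the previous mode is near an extremum and exceeds 1/2 in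
absolute value, a contradiction. -/
theorem eventually_injOn_round :
    ∀ᶠ m : ℕ in atTop, Set.InjOn (fun x : ℝ => round (2 * x - m / 2 - 1 / 2))
      (bernoulliRealRoots m ∩ Set.Icc 0 (modeRange m)) := by
  have key : ∀ᶠ m : ℕ in atTop, Set.InjOn (fun x : ℝ => round (2 * x - (m + 1 : ℕ) / 2 - 1 / 2))
      (bernoulliRealRoots (m + 1) ∩ Set.Icc 0 (modeRange (m + 1))) := by
    -- The slack 2 lets the estimate for index `m` reach `modeRange (m + 1)`.
    filter_upwards [eventually_abs_bernoulliFun_add_mode_le 2 (half_pos one_pos),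
      (tendsto_add_atTop_nat 1).eventually
        (eventually_abs_bernoulliFun_add_mode_le 0 (half_pos one_pos)),
      eventually_ge_atTop 1] with m h0 h1 hm
    have hlt : ∀ x ∈ bernoulliRealRoots (m + 1) ∩ Set.Icc 0 (modeRange (m + 1)),
        ∀ y ∈ bernoulliRealRoots (m + 1) ∩ Set.Icc 0 (modeRange (m + 1)),
        round (2 * x - ((m + 1 : ℕ) : ℝ) / 2 - 1 / 2) =
          round (2 * y - ((m + 1 : ℕ) : ℝ) / 2 - 1 / 2) → ¬ x < y := by
      rintro x ⟨hx, hx0, hxT⟩ y ⟨hy, hy0, hyT⟩ hxy hlt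
      rw [mem_bernoulliRealRoots] at hx hy
      unfold modeRange at hxT hyT
      have hx4 := abs_sub_le_quarter_of_abs_bernoulliMode_le
        (abs_bernoulliMode_le_of_bernoulliFun_eq_zero (h1 x hx0 (by simpa using hxT)) hx)
      have hy4 := abs_sub_le_quarter_of_abs_bernoulliMode_le
        (abs_bernoulliMode_le_of_bernoulliFun_eq_zero (h1 y hy0 (by simpa using hyT)) hy)
      obtain ⟨z, ⟨hxz, hzy⟩, hz⟩ := exists_bernoulliFun_eq_zero_of_lt hlt (hx.trans hy.symm)
      have hz2 := abs_bernoulliMode_le_of_bernoulliFun_eq_zero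
        (h0 z (hx0.trans hxz.le) ((hzy.le.trans hyT).trans (modeRange_succ_le hm))) hz
      rw [← hxy] at hy4
      rw [abs_bernoulliMode_eq_abs_cos m z (round (2 * x - ((m + 1 : ℕ) : ℝ) / 2 - 1 / 2))] at hz2
      rw [abs_le] at hx4 hy4
      have := half_lt_cos_pi_mul (abs_le.mpr ⟨by linarith [hx4.1], by linarith [hy4.2]⟩ :
        |2 * z - ((m + 1 : ℕ) : ℝ) / 2 - 1 / 2
          - round (2 * x - ((m + 1 : ℕ) : ℝ) / 2 - 1 / 2)| ≤ 1 / 4)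
      linarith [le_abs_self (cos (π * (2 * z - ((m + 1 : ℕ) : ℝ) / 2 - 1 / 2
          - round (2 * x - ((m + 1 : ℕ) : ℝ) / 2 - 1 / 2))))]
    intro x hx y hy hxy
    exact le_antisymm (not_lt.mp (hlt y hy x hx hxy.symm)) (not_lt.mp (hlt x hx y hy hxy))
  obtain ⟨M, hM⟩ := eventually_atTop.mp key
  filter_upwards [eventually_ge_atTop (M + 1)] with m hm
  obtain ⟨n, rfl⟩ := Nat.exists_eq_add_of_le' (show 1 ≤ m by lia)
  exact hM n (by lia)

theorem modeRange_nonneg (m : ℕ) : 0 ≤ modeRange m := by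
  have := log_natCast_nonneg m
  unfold modeRange
  positivity

theorem eventually_ncard_bernoulliRealRoots_Icc_modeRange_le :
    ∀ᶠ m : ℕ in atTop, ((bernoulliRealRoots m ∩ Set.Icc 0 (modeRange m)).ncard : ℝ) ≤
      2 * modeRange m + 2 := by
  filter_upwards [eventually_injOn_round] with m hinj
  have hT := modeRange_nonneg m
  set I := Finset.Icc ⌈-(m : ℝ) / 2 - 1⌉ ⌊2 * modeRange m - m / 2⌋ with hI
  have h1 : (bernoulliRealRoots m ∩ Set.Icc 0 (modeRange m)).ncard ≤ (I : Set ℤ).ncard := by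
    refine Set.ncard_le_ncard_of_injOn _ (fun x hx => ?_) hinj I.finite_toSet
    obtain ⟨-, hx0, hxT⟩ := hx
    have := abs_le.mp (abs_sub_round (2 * x - (m : ℝ) / 2 - 1 / 2))
    rw [hI, Finset.mem_coe, Finset.mem_Icc, Int.ceil_le, Int.le_floor]
    exact ⟨by linarith [this.2], by linarith [this.1]⟩
  rw [Set.ncard_coe_finset, hI, Int.card_Icc] at h1
  have h2 : ((bernoulliRealRoots m ∩ Set.Icc 0 (modeRange m)).ncard : ℤ) ≤
      max (⌊2 * modeRange m - m / 2⌋ + 1 - ⌈-(m : ℝ) / 2 - 1⌉) 0 := by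
    rw [← Int.toNat_eq_max]; exact_mod_cast h1
  have h3 : ((bernoulliRealRoots m ∩ Set.Icc 0 (modeRange m)).ncard : ℝ) ≤
      max ((⌊2 * modeRange m - m / 2⌋ : ℝ) + 1 - ⌈-(m : ℝ) / 2 - 1⌉) 0 := by exact_mod_cast h2
  refine h3.trans (max_le ?_ (by linarith))
  linarith [Int.floor_le (2 * modeRange m - (m : ℝ) / 2), Int.le_ceil (-(m : ℝ) / 2 - 1)]

/-! ### Reflection about 1/2 and the upper count -/

theorem numBernoulliRealRoots_le (m : ℕ) :
    numBernoulliRealRoots m ≤ 2 * (bernoulliRealRoots m ∩ Set.Ici 0).ncard := by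
  have hf := (finite_bernoulliRealRoots m).inter_of_left (Set.Ici 0)
  have hsub : bernoulliRealRoots m ⊆ (bernoulliRealRoots m ∩ Set.Ici 0) ∪
      (fun x => 1 - x) '' (bernoulliRealRoots m ∩ Set.Ici 0) := by
    intro x hx
    rcases le_total 0 x with h | h
    · exact Or.inl ⟨hx, h⟩
    · exact Or.inr ⟨1 - x, ⟨one_sub_mem_bernoulliRealRoots hx, by simp; linarith⟩, by simp⟩
  have h1 := Set.ncard_le_ncard hsub (hf.union (hf.image _))
  have h2 := Set.ncard_union_le (bernoulliRealRoots m ∩ Set.Ici 0)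
    ((fun x => 1 - x) '' (bernoulliRealRoots m ∩ Set.Ici 0))
  have h3 := Set.ncard_image_le hf (f := fun x => 1 - x)
  unfold numBernoulliRealRoots
  lia

theorem two_mul_ncard_le_numBernoulliRealRoots (m : ℕ) :
    2 * (bernoulliRealRoots m ∩ Set.Ioi (1 / 2)).ncard ≤ numBernoulliRealRoots m := by
  have hf := (finite_bernoulliRealRoots m).inter_of_left (Set.Ioi (1 / 2))
  have h3 := Set.ncard_image_of_injective (bernoulliRealRoots m ∩ Set.Ioi (1 / 2))
    (sub_right_injective : Function.Injective fun x : ℝ => 1 - x)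
  have hd : Disjoint (bernoulliRealRoots m ∩ Set.Ioi (1 / 2))
      ((fun x => 1 - x) '' (bernoulliRealRoots m ∩ Set.Ioi (1 / 2))) := by
    rw [Set.disjoint_left]
    rintro _ ⟨-, hx⟩ ⟨y, ⟨-, hy⟩, rfl⟩
    simp only [Set.mem_Ioi] at hx hy
    linarith
  have h1 := Set.ncard_union_eq hd hf (hf.image _)
  have h2 : (bernoulliRealRoots m ∩ Set.Ioi (1 / 2)) ∪
      (fun x => 1 - x) '' (bernoulliRealRoots m ∩ Set.Ioi (1 / 2)) ⊆ bernoulliRealRoots m := by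
    rintro _ (⟨hx, -⟩ | ⟨y, ⟨hy, -⟩, rfl⟩)
    · exact hx
    · exact one_sub_mem_bernoulliRealRoots hy
  have h4 := Set.ncard_le_ncard h2 (finite_bernoulliRealRoots m)
  unfold numBernoulliRealRoots
  lia

theorem eventually_numBernoulliRealRoots_le :
    ∀ᶠ m : ℕ in atTop, (numBernoulliRealRoots m : ℝ) ≤
      2 * (2 * modeRange m + 2 + (log m / 4 + 2 * π * exp 1 + 1)) := by
  filter_upwards [eventually_ncard_bernoulliRealRoots_Icc_modeRange_le,
    eventually_ncard_bernoulliRealRoots_gt_modeRange_le] with m h1 h2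
  have hu : bernoulliRealRoots m ∩ Set.Ici 0 =
      (bernoulliRealRoots m ∩ Set.Icc 0 (modeRange m)) ∪
        (bernoulliRealRoots m ∩ Set.Ioi (modeRange m)) := by
    rw [← Set.inter_union_distrib_left, Set.Icc_union_Ioi_eq_Ici (modeRange_nonneg m)]
  have h3 := numBernoulliRealRoots_le m
  rw [hu] at h3
  have h4 : (numBernoulliRealRoots m : ℝ) ≤
      2 * ((bernoulliRealRoots m ∩ Set.Icc 0 (modeRange m)).ncard +
        (bernoulliRealRoots m ∩ Set.Ioi (modeRange m)).ncard) := by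
    exact_mod_cast h3.trans (Nat.mul_le_mul_left 2 (Set.ncard_union_le _ _))
  linarith

/-! ### Lower bounds from sign changes -/

theorem bernoulliMode_quarter_lattice (m : ℕ) (j : ℤ) :
    bernoulliMode m (m / 4 + j / 2) = (-1) ^ j := by
  rw [bernoulliMode, show 2 * π * ((m : ℝ) / 4 + j / 2) - π * m / 2 = j * π by ring,
    cos_int_mul_pi]

theorem eventually_exists_root_of_modeRange :
    ∀ᶠ m : ℕ in atTop, ∀ j : ℤ, 0 ≤ (m : ℝ) / 4 + j / 2 →
      (m : ℝ) / 4 + (j + 1) / 2 ≤ modeRange m →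
      ∃ x ∈ bernoulliRealRoots m,
        (m : ℝ) / 4 + j / 2 < x ∧ x < (m : ℝ) / 4 + (j + 1) / 2 := by
  filter_upwards [eventually_abs_bernoulliFun_add_mode_le 0 (half_pos one_pos)] with m h j h0 hT
  have hA := bernoulliAmp_pos m
  have e1 := h _ h0 (by rw [add_zero]; exact le_trans (by linarith) hT)
  have e2 := h ((m : ℝ) / 4 + ((j + 1 : ℤ) : ℝ) / 2) (by push_cast; linarith)
    (by rw [add_zero]; push_cast; exact hT)
  rw [bernoulliMode_quarter_lattice] at e1 e2
  rw [zpow_add_one₀ (by norm_num)] at e2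
  push_cast at e2
  have hlt : (m : ℝ) / 4 + j / 2 < (m : ℝ) / 4 + (j + 1) / 2 := by linarith
  have hc := (continuous_bernoulliFun m).continuousOn
    (s := Set.Icc ((m : ℝ) / 4 + j / 2) ((m : ℝ) / 4 + (j + 1) / 2))
  simp only [abs_le] at e1 e2
  have hj : (-1 : ℝ) ^ j = 1 ∨ (-1 : ℝ) ^ j = -1 :=
    j.even_or_odd.imp Even.neg_one_zpow Odd.neg_one_zpow
  rcases hj with hj | hj <;> rw [hj] at e1 e2
  · obtain ⟨x, hx, hx'⟩ := intermediate_value_Ioo hlt.le hc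
      (show (0 : ℝ) ∈ _ from ⟨by linarith [e1.2], by linarith [e2.1]⟩)
    exact ⟨x, mem_bernoulliRealRoots.mpr hx', hx.1, hx.2⟩
  · obtain ⟨x, hx, hx'⟩ := intermediate_value_Ioo' hlt.le hc
      (show (0 : ℝ) ∈ _ from ⟨by linarith [e2.2], by linarith [e1.1]⟩)
    exact ⟨x, mem_bernoulliRealRoots.mpr hx', hx.1, hx.2⟩

theorem eventually_le_numBernoulliRealRoots :
    ∀ᶠ m : ℕ in atTop, 2 * (2 * modeRange m - 3) ≤ (numBernoulliRealRoots m : ℝ) := by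
  filter_upwards [eventually_exists_root_of_modeRange] with m h
  -- Indices of the half-periods lying entirely in `[1/2, modeRange m]`.
  set J := Finset.Icc ⌈1 - (m : ℝ) / 2⌉ ⌊2 * modeRange m - m / 2 - 1⌋ with hJ
  have hmem : ∀ j ∈ J, 1 / 2 ≤ (m : ℝ) / 4 + j / 2 ∧ (m : ℝ) / 4 + (j + 1) / 2 ≤ modeRange m := by
    intro j hj
    rw [hJ, Finset.mem_Icc, Int.ceil_le, Int.le_floor] at hj
    exact ⟨by linarith [hj.1], by linarith [hj.2]⟩
  have hex : ∀ j ∈ J, ∃ x ∈ bernoulliRealRoots m,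
      (m : ℝ) / 4 + j / 2 < x ∧ x < (m : ℝ) / 4 + (j + 1) / 2 :=
    fun j hj => h j (by linarith [(hmem j hj).1]) (hmem j hj).2
  choose! g hg hg1 hg2 using hex
  have hfl : ∀ j ∈ J, ⌊2 * g j - m / 2⌋ = j := fun j hj => by
    rw [Int.floor_eq_iff]
    exact ⟨by linarith [hg1 j hj], by linarith [hg2 j hj]⟩
  have h1 : (J : Set ℤ).ncard ≤ (bernoulliRealRoots m ∩ Set.Ioi (1 / 2)).ncard := by
    refine Set.ncard_le_ncard_of_injOn g (fun j hj => ⟨hg j hj, ?_⟩) (fun i hi j hj hij => ?_)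
      ((finite_bernoulliRealRoots m).inter_of_left _)
    · exact (hmem j hj).1.trans_lt (hg1 j hj)
    · rw [← hfl i hi, ← hfl j hj, hij]
  rw [Set.ncard_coe_finset, hJ, Int.card_Icc] at h1
  have h2 : ⌊2 * modeRange m - m / 2 - 1⌋ + 1 - ⌈1 - (m : ℝ) / 2⌉ ≤
      ((bernoulliRealRoots m ∩ Set.Ioi (1 / 2)).ncard : ℤ) :=
    (Int.self_le_toNat _).trans (by exact_mod_cast h1)
  have h3 : (⌊2 * modeRange m - m / 2 - 1⌋ : ℝ) + 1 - ⌈1 - (m : ℝ) / 2⌉ ≤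
      ((bernoulliRealRoots m ∩ Set.Ioi (1 / 2)).ncard : ℝ) := by exact_mod_cast h2
  have h4 : 2 * ((bernoulliRealRoots m ∩ Set.Ioi (1 / 2)).ncard : ℝ) ≤ numBernoulliRealRoots m :=
    by exact_mod_cast two_mul_ncard_le_numBernoulliRealRoots m
  linarith [Int.lt_floor_add_one (2 * modeRange m - (m : ℝ) / 2 - 1),
    Int.ceil_lt_add_one (1 - (m : ℝ) / 2)]

theorem eventually_lt_largestBernoulliRealRoot :
    ∀ᶠ m : ℕ in atTop, modeRange m - 1 < largestBernoulliRealRoot m := by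
  have hE : 0 < 2 * π * exp 1 := by positivity
  filter_upwards [eventually_exists_root_of_modeRange, eventually_ge_atTop 1,
    tendsto_natCast_atTop_atTop.eventually_ge_atTop (2 * π * exp 1)] with m h hm hmE
  have h1 : 1 ≤ modeRange m := by
    have := log_natCast_nonneg m
    unfold modeRange
    rw [one_le_div hE]
    linarith
  have h2 := Int.lt_floor_add_one (2 * modeRange m - (m : ℝ) / 2 - 1)
  have h3 := Int.floor_le (2 * modeRange m - (m : ℝ) / 2 - 1)
  -- The last full half-period below `modeRange m`; its left end exceeds `modeRange m - 1`.
  obtain ⟨x, hx, hx1, -⟩ := h ⌊2 * modeRange m - (m : ℝ) / 2 - 1⌋ (by linarith) (by linarith)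
  have := (isGreatest_largestBernoulliRealRoot hm).2 hx
  linarith

/-! ### Explicit bounds and limits -/

theorem eventually_largestBernoulliRealRoot_bounds :
    ∀ᶠ m : ℕ in atTop, (m : ℝ) / (2 * π * exp 1) - (1 / (π * exp 1) + 1 / 2)
        < largestBernoulliRealRoot m ∧
      largestBernoulliRealRoot m < (m : ℝ) / (2 * π * exp 1) + 1 / (4 * π * exp 1) * log m
        + (1 - 1 / (2 * π * exp 1)) := by
  filter_upwards [eventually_lt_largestBernoulliRealRoot, eventually_bernoulliFun_pos,
    eventually_ge_atTop 1, tendsto_log_natCast.eventually_ge_atTop (8 * π * exp 1)]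
    with m h1 h2 hm hlog
  constructor
  · have e1 : modeRange m = (m : ℝ) / (2 * π * exp 1) + log m / (8 * π * exp 1) := by
      unfold modeRange; field_simp; ring
    have e2 : 1 ≤ log (m : ℝ) / (8 * π * exp 1) := by rwa [one_le_div (by positivity)]
    have e3 : 0 < 1 / (π * exp 1) := by positivity
    linarith
  · by_contra! hle
    refine (h2 _ (le_trans (le_of_eq ?_) hle)).ne'
      (mem_bernoulliRealRoots.mp (isGreatest_largestBernoulliRealRoot hm).1)
    field_simp
    ring

theorem eventually_numBernoulliRealRoots_bounds :
    ∀ᶠ m : ℕ in atTop, 2 * (m : ℝ) / (π * exp 1) - (2 / (π * exp 1) + 2)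
        < (numBernoulliRealRoots m : ℝ) ∧
      (numBernoulliRealRoots m : ℝ) < 2 * (m : ℝ) / (π * exp 1) + log m
        + (4 * π * exp 1 + 3 - 4 / (π * exp 1)) := by
  have hE : 8 < π * exp 1 := by nlinarith [pi_gt_three, exp_one_gt_d9]
  filter_upwards [eventually_le_numBernoulliRealRoots, eventually_numBernoulliRealRoots_le,
    tendsto_log_natCast.eventually_ge_atTop (8 * π * exp 1), eventually_ge_atTop 1]
    with m h1 h2 hlog hm
  have e1 : 4 * modeRange m = 2 * (m : ℝ) / (π * exp 1) + log m / (2 * (π * exp 1)) := by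
    unfold modeRange; field_simp; ring
  -- The logarithm in `4 * modeRange m` absorbs 4 of the constant loss 6 in the lower bound, leaving
  -- 2.
  have e2 : 4 ≤ log (m : ℝ) / (2 * (π * exp 1)) := by
    rw [le_div_iff₀ (by positivity)]; linarith
  have e3 : log (m : ℝ) / (2 * (π * exp 1)) ≤ log m / 16 := by
    have := log_natCast_nonneg m
    gcongr
    linarith
  have e4 : 0 < 2 / (π * exp 1) := by positivity
  have e5 : 4 / (π * exp 1) < 1 := by rw [div_lt_one (by positivity)]; linarith
  exact ⟨by linarith, by linarith⟩

theorem tendsto_div_of_bounds {f : ℕ → ℝ} {c b₁ b₂ b₃ : ℝ}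
    (h : ∀ᶠ m : ℕ in atTop, c * m + b₁ < f m ∧ f m < c * m + b₂ * log m + b₃) :
    Tendsto (fun m : ℕ => f m / m) atTop (𝓝 c) := by
  have hd (b : ℝ) : Tendsto (fun m : ℕ => b / (m : ℝ)) atTop (𝓝 0) :=
    tendsto_const_div_atTop_nhds_zero_nat b
  have hlo : Tendsto (fun m : ℕ => c + b₁ / m) atTop (𝓝 c) := by
    simpa using (hd b₁).const_add c
  have hhi : Tendsto (fun m : ℕ => c + b₂ * (log (m : ℝ) / m) + b₃ / m) atTop (𝓝 c) := by
    simpa using ((tendsto_log_div.const_mul b₂).const_add c).add (hd b₃)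
  refine tendsto_of_tendsto_of_tendsto_of_le_of_le' hlo hhi ?_ ?_
  · filter_upwards [h, eventually_ge_atTop 1] with m hm h1
    have : (0 : ℝ) < m := by positivity
    rw [le_div_iff₀ this, add_mul, div_mul_cancel₀ _ this.ne']
    exact hm.1.le
  · filter_upwards [h, eventually_ge_atTop 1] with m hm h1
    have : (0 : ℝ) < m := by positivity
    rw [div_le_iff₀ this]
    refine hm.2.le.trans (le_of_eq ?_)
    field_simp

theorem mainTheorem4 :
    -- the real roots are finite in number, and for `m ≥ 1` there is a largest one
    (∀ m : ℕ, (bernoulliRealRoots m).Finite) ∧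
    (∀ m : ℕ, 1 ≤ m →
      IsGreatest (bernoulliRealRoots m) (largestBernoulliRealRoot m)) ∧
    -- the bounds for the largest root and for the number of roots, for all large `m`
    (∃ m₀ : ℕ, ∀ m : ℕ, m₀ ≤ m →
      ((m : ℝ) / (2 * Real.pi * Real.exp 1) - (1 / (Real.pi * Real.exp 1) + 1 / 2)
          < largestBernoulliRealRoot m ∧
        largestBernoulliRealRoot m
          < (m : ℝ) / (2 * Real.pi * Real.exp 1)
            + 1 / (4 * Real.pi * Real.exp 1) * Real.log m
            + (1 - 1 / (2 * Real.pi * Real.exp 1))) ∧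
      (2 * (m : ℝ) / (Real.pi * Real.exp 1) - (2 / (Real.pi * Real.exp 1) + 2)
          < (numBernoulliRealRoots m : ℝ) ∧
        (numBernoulliRealRoots m : ℝ)
          < 2 * (m : ℝ) / (Real.pi * Real.exp 1) + Real.log m
            + (4 * Real.pi * Real.exp 1 + 3 - 4 / (Real.pi * Real.exp 1)))) ∧
    -- the limits
    Filter.Tendsto (fun m : ℕ => (numBernoulliRealRoots m : ℝ) / (m : ℝ))
      Filter.atTop (nhds (2 / (Real.pi * Real.exp 1))) ∧
    Filter.Tendsto (fun m : ℕ => largestBernoulliRealRoot m / (m : ℝ))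
      Filter.atTop (nhds (1 / (2 * Real.pi * Real.exp 1))) := by
  refine ⟨finite_bernoulliRealRoots, fun m hm => isGreatest_largestBernoulliRealRoot hm,
    eventually_atTop.mp (eventually_largestBernoulliRealRoot_bounds.and
      eventually_numBernoulliRealRoots_bounds), ?_, ?_⟩
  · refine tendsto_div_of_bounds (b₁ := -(2 / (π * exp 1) + 2)) (b₂ := 1)
      (b₃ := 4 * π * exp 1 + 3 - 4 / (π * exp 1)) ?_
    filter_upwards [eventually_numBernoulliRealRoots_bounds] with m hm
    rw [div_mul_eq_mul_div, one_mul, ← sub_eq_add_neg]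
    exact hm
  · refine tendsto_div_of_bounds (b₁ := -(1 / (π * exp 1) + 1 / 2))
      (b₂ := 1 / (4 * π * exp 1)) (b₃ := 1 - 1 / (2 * π * exp 1)) ?_
    filter_upwards [eventually_largestBernoulliRealRoot_bounds] with m hm
    rw [div_mul_eq_mul_div, one_mul, ← sub_eq_add_neg]
    exact hm
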